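/- Let $p=2$ and $q=p^2=4$, and let $\Omega$ be a field containing $\mathbb F_{16}$ (hence $\mathbb F_2\subset\mathbb F_4\subset\mathbb F_{16}\subset\Omega$). Let $x_1\in\Omega$ be transcendental over $\mathbb F_2$, and let $x_k$ ($k\ge 1$) and $z_k,t_k$ ($k\ge 2$) be elements of $\Omega$ with $$z_{k+1}^4+z_{k+1}=x_k^5,\qquad t_{k+1}^2+t_{k+1}=x_k^5,\qquad x_{k+1}=\frac{z_{k+1}}{x_k}\qquad(k\ge 1).$$ (If $\Omega$ is algebraically closed, such elements exist for every $x_1\in\Omega$ transcendental over $\mathbb F_2$.) For $K\in\{\mathbb F_2,\mathbb F_4,\mathbb F_{16}\}$ put $E^K_{1,0}=K(x_1)$ and, for $k\ge 1$, $E^K_{k,1}=E^K_{k,0}(t_{k+1})$ and $E^K_{k+1,0}=E^K_{k,0}(z_{k+1})$. Write $H_{k,s}=E^{\mathbb F_2}_{k,s}$, $G_{k,s}=E^{\mathbb F_4}_{k,s}$, $F_{k,s}=E^{\mathbb F_{16}}_{k,s}$ for $k\ge1$ and $s=0,1$. Thus $T_1=(F_{k,s})$ is the densified Garcia–Stichtenoth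 tower over $\mathbb F_{16}$. Then the tower $T_1$ descends from $\mathbb F_{16}$ to $\mathbb F_2$. More precisely: 1. For each $K\in\{\mathbb F_2,\mathbb F_4,\mathbb F_{16}\}$, the fields $E^K_{1,0}\subset E^K_{1,1}\subset E^K_{2,0}\subset E^K_{2,1}\subset\cdots$ form a tower of algebraic function fields of one variable with full constant field $K$, in which every step $E^K_{k,1}/E^K_{k,0}$ and $E^K_{k+1,0}/E^K_{k,1}$ is Galois of degree $2$. In particular $T_1=(F_{k,s})$, $T_2=(G_{k,s})$ and $T_3=(H_{k,s})$ are towers over $\mathbb F_{16}$, $\mathbb F_4$ and $\mathbb F_2$ respectively. 2. For all $k\ge 1$ and $s=0,1$, $$F_{k,s}=\mathbb F_{16}H_{k,s},\qquad G_{k,s}=\mathbb F_4H_{k,s},\qquad F_{k,s}=\mathbb F_{16}G_{k,s},$$ and $F_{k,s}/\mathbb F_{16}$ is the constant field extension of both $H_{k,s}/\mathbb F_2$ and $G_{k,s}/\mathbb F_4$, and $G_{k,s}/\mathbb F_4$ is the constant field extension of $H_{k,s}/\mathbb F_2$. -/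

import Mathlib

open IntermediateField

/-- `L / K` is an algebraic function field of one variable with full constant field `K`:
`L` is finite over `K(y)` for some `y` transcendental over `K`, and every element of `L`
algebraic over `K` lies in `K`. -/
structure IsFunctionField (K L : Type*) [Field K] [Field L] [Algebra K L] : Prop where
  exists_finite : ∃ y : L, Transcendental K y ∧ FiniteDimensional K⟮y⟯ L
  full_constant_field : algebraicClosure K L = ⊥

section Towers

variable {Ω : Type*} [Field Ω]

/-- The equations of the Garcia–Stichtenoth tower, for a given `q`:
`z_{k+1}^q + z_{k+1} = x_k^{q+1}` and `x_{k+1} = z_{k+1} / x_k` for all `k ≥ 1`.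
The entries `x 0`, `z 0` and `z 1` play no role. -/
structure IsGarciaStichtenothSequence (q : ℕ) (x z : ℕ → Ω) : Prop where
  eqn : ∀ k, 1 ≤ k → z (k + 1) ^ q + z (k + 1) = x k ^ (q + 1)
  quot : ∀ k, 1 ≤ k → x (k + 1) = z (k + 1) / x k

/-- The generators of the densified tower for `p = 2`, `q = 4`: `x_1` is transcendental over
`𝔽₂`, the `z_k`, `x_k` satisfy the Garcia–Stichtenoth equations, and
`t_{k+1}^2 + t_{k+1} = x_k^5` for all `k ≥ 1`. -/
structure IsDensifiedSequence [Algebra (ZMod 2) Ω] (x z t : ℕ → Ω) : Prop where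
  transcendental : Transcendental (ZMod 2) (x 1)
  gs : IsGarciaStichtenothSequence 4 x z
  eqn_t : ∀ k, 1 ≤ k → t (k + 1) ^ 2 + t (k + 1) = x k ^ 5

section Base

variable (K : Type*) [Field K] [Algebra K Ω]

/-- The steps over the constant field `K`: `E_1 = K(x_1)` and `E_{k+1} = E_k(z_{k+1})` for
`k ≥ 1`; the value at index `0` is a dummy. -/
def gsStep (x z : ℕ → Ω) : ℕ → IntermediateField K Ω
  | 0 => ⊥
  | 1 => K⟮x 1⟯
  | k + 2 => gsStep x z (k + 1) ⊔ K⟮z (k + 2)⟯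

/-- The densified tower over `K`: `E_{k,0} = E_k` and `E_{k,1} = E_k(t_{k+1})`. -/
def densifiedStep (x z t : ℕ → Ω) (k : ℕ) (s : Fin 2) : IntermediateField K Ω :=
  if s = 0 then gsStep K x z k else gsStep K x z k ⊔ K⟮t (k + 1)⟯

variable {K}

/-- `A ⊆ B`, and `B / A` is a Galois extension of degree `2`. -/
def IsQuadraticGalois (A B : IntermediateField K Ω) : Prop :=
  ∃ h : A ≤ B, IsGalois A (extendScalars h) ∧ Module.finrank A (extendScalars h) = 2

/-- `E_{1,0} ⊂ E_{1,1} ⊂ E_{2,0} ⊂ E_{2,1} ⊂ ⋯` is a tower of function fields with full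
constant field `K`, all of whose consecutive steps are Galois of degree `2`. -/
structure IsQuadraticTower (E : ℕ → Fin 2 → IntermediateField K Ω) : Prop where
  functionField : ∀ k, 1 ≤ k → ∀ s, IsFunctionField K (E k s)
  step_mid : ∀ k, 1 ≤ k → IsQuadraticGalois (E k 0) (E k 1)
  step_next : ∀ k, 1 ≤ k → IsQuadraticGalois (E k 1) (E (k + 1) 0)

/-- For subfields `L / K` and `L' / K'` of `Ω`, `L' / K'` is the constant field extension of
`L / K`: both are function fields with the indicated full constant fields, `K ⊆ K'` is an
algebraic extension inside `Ω`, and `L' = K' L` (compositum in `Ω`). -/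
structure IsConstantFieldExtension {K' : Type*} [Field K'] [Algebra K' Ω]
    (L : IntermediateField K Ω) (L' : IntermediateField K' Ω) : Prop where
  base : IsFunctionField K L
  top : IsFunctionField K' L'
  constants_le : (algebraMap K Ω).fieldRange ≤ (algebraMap K' Ω).fieldRange
  constants_algebraic : ∀ c : K', IsAlgebraic K (algebraMap K' Ω c)
  compositum : L' = adjoin K' (L : Set Ω)

end Base

end Towers

/-!
All the fields in question are compared at one place over the pole of `x 1`. Let `K` have
characteristic two and let `v` be a valuation of `Ω`, trivial on `K`, with `v (x 1) > 1`; such a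
`v` exists because `x 1` is transcendental over `K`. Put `T = z ^ 2 + z` for `z = z (k + 1)`, so
that `T ^ 2 + T = z ^ 4 + z = x k ^ 5`; since `t (k + 1)` is `T` or `T + 1`, it may be replaced by
`T`. Up to factors congruent to `1` modulo the maximal ideal of `v`, the element `ϖ = T / x k ^ 2`
satisfies `x k = ϖ ^ 2` and `T = ϖ ^ 5`, and `y = x (k + 1) = z / x k` satisfies `ϖ = y ^ 2` and
`z = y ^ 5` (`ramified_tower_step`). So at each quadratic step the old parameter is the square of
the new one, while the generator is an odd power of it.

The invariant carried along the tower is that each nonzero element of the field is `c * ϖ ^ n` times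
a principal unit, with `c ∈ K` and `ϖ` the current parameter (`HasLeadingTerm`); in other words,
the place is rational over `K` with parameter `ϖ⁻¹`. It holds for `K(x 1)` by comparing degrees. In
`E(t) = E + E t` the pole orders on `E` are even and those on `E t` are odd, so that no cancellation
occurs and the invariant passes to `E(t)`; the same parity shows `t ∉ E`, so the Artin–Schreier
extension `E(t) / E` has degree `2`. Finally, an element algebraic over `K` has value `1`, so its
leading term is a constant `c`, and subtracting `c` yields an algebraic element of value `< 1`, that
is, `0`: the constant field is `K` (`HasLeadingTerm.mem_range_of_isAlgebraic`).

This applies to each of the finite fields `K` separately. The fields over different `K` have the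
same generators, hence are obtained from one another by composition with the larger finite field.
-/

/-! ### Valuations and leading terms -/

section LeadingTerms

variable {K Ω Γ₀ : Type*} [Field K] [Field Ω] [Algebra K Ω] [LinearOrderedCommGroupWithZero Γ₀]

/-- If `x` is transcendental over `K`, some valuation ring of `Ω` contains `K` but not `x`: a
place over `x = ∞`. -/
theorem exists_valuationSubring_of_transcendental {x : Ω} (hx : Transcendental K x) :
    ∃ V : ValuationSubring Ω, (∀ c : K, algebraMap K Ω c ∈ V) ∧ x ∉ V := by
  have hx0 : x ≠ 0 := fun h ↦ hx (h ▸ isAlgebraic_zero)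
  let A : Subalgebra K Ω := Algebra.adjoin K {x⁻¹}
  let ξ : A.toSubring := ⟨x⁻¹, Algebra.subset_adjoin rfl⟩
  have hI : Ideal.span {ξ} ≠ ⊤ := by
    intro h
    obtain ⟨⟨a, ha⟩, hab⟩ := Ideal.mem_span_singleton.1 ((Ideal.eq_top_iff_one _).1 h)
    have hab' : (1 : Ω) = x⁻¹ * a := congrArg Subtype.val hab
    have ha' : a ∈ Algebra.adjoin K {x⁻¹} := ha
    rw [Algebra.adjoin_singleton_eq_range_aeval] at ha'
    obtain ⟨p, hp⟩ := ha'
    replace hp : Polynomial.aeval x⁻¹ p = a := hp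
    refine hx (IsAlgebraic.inv_iff.1 ⟨Polynomial.X * p - 1, fun h0 ↦ ?_, ?_⟩)
    · simpa using congrArg (Polynomial.eval 0) h0
    · simp [hp, ← hab']
  obtain ⟨V, hAV, hV⟩ := Ideal.image_subset_nonunits_valuationSubring _ hI
  refine ⟨V, fun c ↦ hAV (A.algebraMap_mem c), ?_⟩
  exact (V.inv_mem_nonunits_iff.1 (hV ⟨ξ, Ideal.subset_span rfl, rfl⟩)).resolve_left hx0

/-- A principal unit of the valuation `v`: an element congruent to `1` modulo the maximal ideal. -/
def IsPrincipalUnit (v : Valuation Ω Γ₀) (u : Ω) : Prop := v (u - 1) < 1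

variable {v : Valuation Ω Γ₀}

theorem IsPrincipalUnit.one : IsPrincipalUnit v 1 := by simp [IsPrincipalUnit]

theorem IsPrincipalUnit.one_add {a : Ω} (ha : v a < 1) : IsPrincipalUnit v (1 + a) := by
  simpa [IsPrincipalUnit] using ha

theorem IsPrincipalUnit.map_eq_one {u : Ω} (hu : IsPrincipalUnit v u) : v u = 1 := by
  simpa using v.map_one_add_of_lt hu

theorem IsPrincipalUnit.ne_zero {u : Ω} (hu : IsPrincipalUnit v u) : u ≠ 0 := by
  rintro rfl
  simpa using hu.map_eq_one

theorem IsPrincipalUnit.mul {u w : Ω} (hu : IsPrincipalUnit v u) (hw : IsPrincipalUnit v w) :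
    IsPrincipalUnit v (u * w) := by
  have h : u * w - 1 = u * (w - 1) + (u - 1) := by ring
  rw [IsPrincipalUnit, h]
  refine v.map_add_lt ?_ hu
  rw [map_mul, hu.map_eq_one, one_mul]
  exact hw

theorem IsPrincipalUnit.inv {u : Ω} (hu : IsPrincipalUnit v u) : IsPrincipalUnit v u⁻¹ := by
  have h : u⁻¹ - 1 = u⁻¹ * (1 - u) := by field_simp [hu.ne_zero]
  rw [IsPrincipalUnit, h, map_mul, map_inv₀, hu.map_eq_one, inv_one, one_mul, v.map_sub_swap]
  exact hu

theorem IsPrincipalUnit.pow {u : Ω} (hu : IsPrincipalUnit v u) (n : ℕ) :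
    IsPrincipalUnit v (u ^ n) := by
  induction n with
  | zero => simpa using IsPrincipalUnit.one
  | succ n ih => simpa [pow_succ] using ih.mul hu

theorem IsPrincipalUnit.zpow {u : Ω} (hu : IsPrincipalUnit v u) (n : ℤ) :
    IsPrincipalUnit v (u ^ n) := by
  obtain ⟨m, rfl | rfl⟩ := n.eq_nat_or_neg
  · simpa using hu.pow m
  · simpa using (hu.pow m).inv

/-- `f` has leading term `c * ϖ ^ n` with a nonzero coefficient `c ∈ K`, that is, `f / (c * ϖ ^ n)`
is a principal unit. Here `ϖ` is meant to have a pole, so `n` is the pole order of `f`. -/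
def HasLeadingTerm (K : Type*) [Field K] [Algebra K Ω] (v : Valuation Ω Γ₀) (ϖ : Ω) (n : ℤ)
    (f : Ω) : Prop :=
  ∃ c : K, c ≠ 0 ∧ ∃ u, IsPrincipalUnit v u ∧ f = algebraMap K Ω c * ϖ ^ n * u

theorem HasLeadingTerm.mul {ϖ f g : Ω} {m n : ℤ} (hϖ : ϖ ≠ 0) (hf : HasLeadingTerm K v ϖ m f)
    (hg : HasLeadingTerm K v ϖ n g) : HasLeadingTerm K v ϖ (m + n) (f * g) := by
  obtain ⟨c, hc, u, hu, rfl⟩ := hf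
  obtain ⟨d, hd, w, hw, rfl⟩ := hg
  refine ⟨c * d, mul_ne_zero hc hd, u * w, hu.mul hw, ?_⟩
  rw [map_mul, zpow_add₀ hϖ]
  ring

theorem HasLeadingTerm.inv {ϖ f : Ω} {n : ℤ} (hf : HasLeadingTerm K v ϖ n f) :
    HasLeadingTerm K v ϖ (-n) f⁻¹ := by
  obtain ⟨c, hc, u, hu, rfl⟩ := hf
  refine ⟨c⁻¹, inv_ne_zero hc, u⁻¹, hu.inv, ?_⟩
  rw [map_inv₀, zpow_neg, mul_inv, mul_inv]

section TrivialOnConstants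

variable (hv : ∀ c : K, c ≠ 0 → v (algebraMap K Ω c) = 1)
include hv

theorem HasLeadingTerm.map_eq {ϖ f : Ω} {n : ℤ} (hf : HasLeadingTerm K v ϖ n f) :
    v f = v ϖ ^ n := by
  obtain ⟨c, hc, u, hu, rfl⟩ := hf
  simp [hv c hc, hu.map_eq_one]

theorem HasLeadingTerm.add_of_lt {ϖ f g : Ω} {m n : ℤ} (hϖ : 1 < v ϖ) (hmn : n < m)
    (hf : HasLeadingTerm K v ϖ m f) (hg : HasLeadingTerm K v ϖ n g) :
    HasLeadingTerm K v ϖ m (f + g) := by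
  have hgf : v g < v f := by
    rw [hf.map_eq hv, hg.map_eq hv]
    exact zpow_lt_zpow_right₀ hϖ hmn
  have hf0 : f ≠ 0 := v.ne_zero_iff.1 (ne_of_gt (zero_le.trans_lt hgf))
  have hu' : IsPrincipalUnit v (1 + g / f) := by
    refine .one_add ?_
    rw [map_div₀]
    exact (div_lt_one₀ (zero_le.trans_lt hgf)).2 hgf
  obtain ⟨c, hc, u, hu, hfu⟩ := hf
  refine ⟨c, hc, u * (1 + g / f), hu.mul hu', ?_⟩
  rw [← mul_assoc, ← hfu]
  field_simp

theorem HasLeadingTerm.unique {ϖ f : Ω} {m n : ℤ} (hϖ : 1 < v ϖ)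
    (hm : HasLeadingTerm K v ϖ m f) (hn : HasLeadingTerm K v ϖ n f) : m = n :=
  (zpow_right_strictMono₀ hϖ).injective ((hm.map_eq hv).symm.trans (hn.map_eq hv))

/-- At a pole of `x`, a nonzero polynomial in `x` has the leading term of the polynomial. -/
theorem hasLeadingTerm_aeval {x : Ω} (hx : 1 < v x) {p : Polynomial K} (hp : p ≠ 0) :
    HasLeadingTerm K v x p.natDegree (Polynomial.aeval x p) := by
  have hx0 : x ≠ 0 := v.ne_zero_iff.1 (ne_of_gt (zero_lt_one.trans hx))
  have hl : algebraMap K Ω p.leadingCoeff ≠ 0 := by simpa using hp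
  have hxn : x ^ p.natDegree ≠ 0 := pow_ne_zero _ hx0
  have hv1 : ∀ c : K, v (algebraMap K Ω c) ≤ 1 := fun c ↦ by
    by_cases hc : c = 0
    · simp [hc]
    · exact (hv c hc).le
  refine ⟨p.leadingCoeff, by simpa using hp, _, IsPrincipalUnit.one_add
    (a := (∑ i ∈ Finset.range p.natDegree, p.coeff i • x ^ i) /
      (algebraMap K Ω p.leadingCoeff * x ^ p.natDegree)) ?_, ?_⟩
  · rw [map_div₀, map_mul, hv _ (by simpa using hp), one_mul, map_pow,
      div_lt_one₀ (pow_pos (zero_lt_one.trans hx) _)]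
    refine v.map_sum_lt (pow_ne_zero _ (zero_lt_one.trans hx).ne') fun i hi ↦ ?_
    rw [Algebra.smul_def, map_mul, map_pow]
    calc v (algebraMap K Ω (p.coeff i)) * v x ^ i ≤ 1 * v x ^ i := by gcongr; exact hv1 _
      _ = v x ^ i := one_mul _
      _ < v x ^ p.natDegree := pow_lt_pow_right₀ hx (Finset.mem_range.1 hi)
  · rw [Polynomial.aeval_eq_sum_range, Finset.sum_range_succ, zpow_natCast,
      Polynomial.coeff_natDegree, mul_add, mul_one, mul_div_cancel₀ _ (mul_ne_zero hl hxn),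
      Algebra.smul_def, add_comm]

/-- An element algebraic over `K` that has a leading term is a constant: it has value `1`, so its
leading term is some `c ∈ K`, and the difference with `c`, again algebraic, has value `< 1`. -/
theorem HasLeadingTerm.mem_range_of_isAlgebraic {ϖ f : Ω} {n : ℤ} (hϖ : 1 < v ϖ)
    (hf : HasLeadingTerm K v ϖ n f) (hint : IsAlgebraic K f) :
    f ∈ (algebraMap K Ω).range := by
  have hle (a : Ω) (ha : IsAlgebraic K a) : v a ≤ 1 := by
    by_contra! h
    obtain ⟨p, hp, hpa⟩ := ha
    have := (hasLeadingTerm_aeval hv h hp).map_eq hv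
    rw [hpa, map_zero] at this
    exact zpow_ne_zero _ (zero_lt_one.trans h).ne' this.symm
  have h1 (a : Ω) (ha : IsAlgebraic K a) (ha0 : a ≠ 0) : v a = 1 := by
    refine le_antisymm (hle a ha) ?_
    have := hle _ ha.inv
    rw [map_inv₀] at this
    exact (inv_le_one₀ (zero_lt_iff.2 (v.ne_zero_iff.2 ha0))).1 this
  have hv1 := hf.map_eq hv
  obtain ⟨c, hc, u, hu, rfl⟩ := hf
  have hϖ0 : ϖ ≠ 0 := v.ne_zero_iff.1 (ne_of_gt (zero_lt_one.trans hϖ))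
  have hc0 : algebraMap K Ω c ≠ 0 := by simpa using hc
  rw [h1 _ hint (by simp [hc, hϖ0, hu.ne_zero, zpow_ne_zero])] at hv1
  have hn : n = 0 := (zpow_right_strictMono₀ hϖ).injective (by simpa using hv1.symm)
  subst hn
  simp only [zpow_zero, mul_one] at hint ⊢
  have hdiff : IsAlgebraic K (algebraMap K Ω c * u - algebraMap K Ω c) :=
    hint.sub (isAlgebraic_algebraMap c)
  by_cases h0 : algebraMap K Ω c * u - algebraMap K Ω c = 0
  · exact ⟨c, (sub_eq_zero.1 h0).symm⟩
  · refine absurd (h1 _ hdiff h0) (ne_of_lt ?_)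
    rw [← mul_sub_one, map_mul, hv c hc, one_mul]
    exact hu

/-- Every nonzero element of the rational function field `K(x)` has a leading term at `x = ∞`. -/
theorem hasLeadingTerm_adjoin_simple {x : Ω} (hx : 1 < v x) {f : Ω} (hf : f ∈ K⟮x⟯) (hf0 : f ≠ 0) :
    ∃ n, HasLeadingTerm K v x n f := by
  have hx0 : x ≠ 0 := v.ne_zero_iff.1 (ne_of_gt (zero_lt_one.trans hx))
  obtain ⟨r, s, rfl⟩ := (mem_adjoin_simple_iff K f).1 hf
  have hr : r ≠ 0 := by rintro rfl; simp at hf0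
  have hs : s ≠ 0 := by rintro rfl; simp at hf0
  rw [div_eq_mul_inv]
  exact ⟨_, (hasLeadingTerm_aeval hv hx hr).mul hx0 (hasLeadingTerm_aeval hv hx hs).inv⟩

end TrivialOnConstants

/-- If `t` is a root of `X ^ 2 + X - a` with `a ∈ E`, then `E(t) = E + E t`. -/
theorem exists_eq_add_mul_of_mem_sup_adjoin_simple {E : IntermediateField K Ω} {t : Ω}
    (ht : t ^ 2 + t ∈ E) {f : Ω} (hf : f ∈ E ⊔ K⟮t⟯) : ∃ g ∈ E, ∃ h ∈ E, f = g + h * t := by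
  have hint : IsIntegral E t :=
    ⟨Polynomial.X ^ 2 + Polynomial.X - Polynomial.C ⟨_, ht⟩, by monicity!,
      by simp [IntermediateField.algebraMap_apply]⟩
  rw [← restrictScalars_adjoin_eq_sup, mem_restrictScalars, ← mem_toSubalgebra,
    adjoin_simple_toSubalgebra_of_isAlgebraic hint.isAlgebraic] at hf
  induction hf using Algebra.adjoin_induction with
  | mem x hx => exact ⟨0, E.zero_mem, 1, E.one_mem, by simp [Set.mem_singleton_iff.1 hx]⟩
  | algebraMap r => exact ⟨r, r.2, 0, E.zero_mem, by simp [IntermediateField.algebraMap_apply]⟩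
  | add x y _ _ hx hy =>
    obtain ⟨g, hg, h, hh, rfl⟩ := hx
    obtain ⟨g', hg', h', hh', rfl⟩ := hy
    exact ⟨g + g', add_mem hg hg', h + h', add_mem hh hh', by ring⟩
  | mul x y _ _ hx hy =>
    obtain ⟨g, hg, h, hh, rfl⟩ := hx
    obtain ⟨g', hg', h', hh', rfl⟩ := hy
    refine ⟨g * g' + h * h' * (t ^ 2 + t), add_mem (mul_mem hg hg') (mul_mem (mul_mem hh hh') ht),
      g * h' + h * g' - h * h', sub_mem (add_mem (mul_mem hg hh') (mul_mem hh hg'))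
        (mul_mem hh hh'), by ring⟩

section Ramified

variable (hv : ∀ c : K, c ≠ 0 → v (algebraMap K Ω c) = 1) {E : IntermediateField K Ω}
  {π ϖ w w' t : Ω} {m : ℤ} (hE : ∀ f ∈ E, f ≠ 0 → ∃ n, HasLeadingTerm K v π n f)
  (hϖ : 1 < v ϖ) (hw : IsPrincipalUnit v w) (hπ : π = ϖ ^ 2 * w) (hm : Odd m)
  (hw' : IsPrincipalUnit v w') (ht : t = ϖ ^ m * w')

include hE hw hπ in
/-- If `π` has a double pole with respect to `ϖ`, all pole orders of elements of `E` with respect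
to `ϖ` are even. -/
theorem exists_even_hasLeadingTerm {f : Ω} (hf : f ∈ E) (hf0 : f ≠ 0) :
    ∃ n, Even n ∧ HasLeadingTerm K v ϖ n f := by
  obtain ⟨n, c, hc, u, hu, rfl⟩ := hE f hf hf0
  refine ⟨2 * n, even_two_mul n, c, hc, w ^ n * u, (hw.zpow n).mul hu, ?_⟩
  rw [hπ, mul_zpow, zpow_mul, zpow_ofNat]
  ring

include hw' ht in
theorem hasLeadingTerm_of_eq_zpow_mul : HasLeadingTerm K v ϖ m t :=
  ⟨1, one_ne_zero, w', hw', by rw [map_one, one_mul, ht]⟩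

include hv hE hϖ hw hπ hm hw' ht

/-- Ramification makes the extension nontrivial: `t` has odd pole order. -/
theorem notMem_of_odd_pole : t ∉ E := by
  intro h
  have hϖ0 : ϖ ≠ 0 := v.ne_zero_iff.1 (ne_of_gt (zero_lt_one.trans hϖ))
  have ht0 : t ≠ 0 := ht ▸ mul_ne_zero (zpow_ne_zero _ hϖ0) hw'.ne_zero
  obtain ⟨n, hn, hnt⟩ := exists_even_hasLeadingTerm hE hw hπ h ht0
  have := hnt.unique hv hϖ (hasLeadingTerm_of_eq_zpow_mul hw' ht)
  exact Int.not_even_iff_odd.2 hm (this ▸ hn)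

/-- In `E(t) = E + E t` the two summands have pole orders of different parity, so one of them
dominates the sum: leading terms with respect to `π` on `E` yield leading terms with respect to `ϖ`
on `E(t)`. -/
theorem exists_hasLeadingTerm_sup_adjoin_simple (hq : t ^ 2 + t ∈ E) {f : Ω} (hf : f ∈ E ⊔ K⟮t⟯)
    (hf0 : f ≠ 0) : ∃ n, HasLeadingTerm K v ϖ n f := by
  have hϖ0 : ϖ ≠ 0 := v.ne_zero_iff.1 (ne_of_gt (zero_lt_one.trans hϖ))
  obtain ⟨g, hg, h, hh, rfl⟩ := exists_eq_add_mul_of_mem_sup_adjoin_simple hq hf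
  have htm : HasLeadingTerm K v ϖ m t := hasLeadingTerm_of_eq_zpow_mul hw' ht
  rcases eq_or_ne g 0 with rfl | hg0
  · have hh0 : h ≠ 0 := by rintro rfl; simp at hf0
    obtain ⟨n, -, hn⟩ := exists_even_hasLeadingTerm hE hw hπ hh hh0
    exact ⟨_, by simpa using hn.mul hϖ0 htm⟩
  obtain ⟨n, hne, hn⟩ := exists_even_hasLeadingTerm hE hw hπ hg hg0
  rcases eq_or_ne h 0 with rfl | hh0
  · exact ⟨n, by simpa using hn⟩
  obtain ⟨n', hne', hn'⟩ := exists_even_hasLeadingTerm hE hw hπ hh hh0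
  have hht := hn'.mul hϖ0 htm
  have hne'' : n ≠ n' + m := by
    rintro rfl
    exact Int.not_even_iff_odd.2 (hne'.add_odd hm) hne
  rcases lt_or_gt_of_ne hne'' with hlt | hlt
  · rw [add_comm]
    exact ⟨_, hht.add_of_lt hv hϖ hlt hn⟩
  · exact ⟨_, hn.add_of_lt hv hϖ hlt hht⟩

end Ramified

end LeadingTerms

/-! ### Artin–Schreier steps -/

section ArtinSchreier

variable {K Ω : Type*} [Field K] [Field Ω] [Algebra K Ω]

theorem isQuadraticGalois_sup_adjoin_simple [CharP Ω 2] {E : IntermediateField K Ω} {t : Ω}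
    (ht : t ^ 2 + t ∈ E) (htE : t ∉ E) : IsQuadraticGalois E (E ⊔ K⟮t⟯) := by
  have : CharP E 2 := (algebraMap E Ω).charP (algebraMap E Ω).injective 2
  have h2 : (2 : E) = 0 := CharTwo.two_eq_zero
  refine ⟨le_sup_left, ?_⟩
  have hext : extendScalars (le_sup_left : E ≤ E ⊔ K⟮t⟯) = E⟮t⟯ :=
    restrictScalars_injective K (by
      rw [extendScalars_restrictScalars, restrictScalars_adjoin_eq_sup])
  rw [hext]
  let p : Polynomial E := Polynomial.X ^ 2 + Polynomial.X - Polynomial.C ⟨_, ht⟩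
  have hp : p.Monic := by simp only [p]; monicity!
  have hpt : Polynomial.aeval t p = 0 := by simp [p, IntermediateField.algebraMap_apply]
  have hint : IsIntegral E t := ⟨p, hp, hpt⟩
  have hsep : p.Separable := by
    -- the derivative of `p` is `1`
    rw [Polynomial.separable_def]
    have : p.derivative = 1 := by
      simp [p, one_add_one_eq_two, h2]
    rw [this]
    exact isCoprime_one_right
  have : Algebra.IsSeparable E E⟮t⟯ := by
    rw [isSeparable_adjoin_simple_iff_isSeparable]
    exact hsep.of_dvd (minpoly.dvd E t hpt)
  have hfin : Module.finrank E E⟮t⟯ = 2 := by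
    rw [adjoin.finrank hint]
    refine le_antisymm ?_ ((minpoly.two_le_natDegree_iff hint).2 ?_)
    · refine (Polynomial.natDegree_le_of_dvd (minpoly.dvd E t hpt) hp.ne_zero).trans ?_
      simp only [p]
      compute_degree
    · rintro ⟨a, rfl⟩
      exact htE a.2
  have : Algebra.IsQuadraticExtension E E⟮t⟯ := ⟨hfin⟩
  exact ⟨inferInstance, hfin⟩

/-- In characteristic `2` the roots of `X ^ 2 + X - a` are `t` and `t + 1`, so they generate the
same field. -/
theorem adjoin_simple_eq_of_sq_add_self_eq [CharP Ω 2] {t s : Ω} (h : t ^ 2 + t = s ^ 2 + s) :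
    K⟮t⟯ = K⟮s⟯ := by
  have h' : (t - s) * (t + s + 1) = 0 := by linear_combination h
  rcases mul_eq_zero.1 h' with h0 | h0
  · rw [sub_eq_zero.1 h0]
  · have hts : t = -(s + 1) := by linear_combination h0
    apply le_antisymm <;> rw [adjoin_simple_le_iff]
    · rw [hts]
      exact neg_mem (add_mem (mem_adjoin_simple_self K s) (one_mem _))
    · rw [show s = -(t + 1) by rw [hts]; ring]
      exact neg_mem (add_mem (mem_adjoin_simple_self K t) (one_mem _))

theorem sup_adjoin_simple_sq_add_self (E : IntermediateField K Ω) (z : Ω) :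
    E ⊔ K⟮z ^ 2 + z⟯ ⊔ K⟮z⟯ = E ⊔ K⟮z⟯ := by
  have h : K⟮z ^ 2 + z⟯ ≤ K⟮z⟯ := by
    rw [adjoin_simple_le_iff]
    exact add_mem (pow_mem (mem_adjoin_simple_self K z) 2) (mem_adjoin_simple_self K z)
  rw [sup_assoc, sup_eq_right.2 h]

end ArtinSchreier

section TowerStep

variable {K Ω Γ₀ : Type*} [Field K] [Field Ω] [Algebra K Ω] [LinearOrderedCommGroupWithZero Γ₀]
  {v : Valuation Ω Γ₀}

theorem one_lt_map_of_one_lt_map_sq_add_self {t : Ω} (h : 1 < v (t ^ 2 + t)) : 1 < v t := by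
  by_contra! ht
  refine h.not_ge (v.map_add_le ?_ ht)
  rw [map_pow]
  exact pow_le_one₀ zero_le ht

theorem one_lt_map_of_eq_sq_mul {π ϖ w : Ω} (hπ : 1 < v π) (hw : IsPrincipalUnit v w)
    (h : π = ϖ ^ 2 * w) : 1 < v ϖ := by
  by_contra! hϖ
  refine hπ.not_ge ?_
  rw [h, map_mul, map_pow, hw.map_eq_one, mul_one]
  exact pow_le_one₀ zero_le hϖ

/-- One step of the Garcia–Stichtenoth tower at a place where `x` has a simple pole: `z ^ 2 + z` and
`z` both have odd pole order over the preceding field, so both quadratic extensions are totally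
ramified, and `z / x` again has a simple pole. -/
theorem ramified_tower_step [CharP Ω 2] (hv : ∀ c : K, c ≠ 0 → v (algebraMap K Ω c) = 1)
    {E : IntermediateField K Ω} {x z : Ω} (hxE : x ∈ E) (hx : 1 < v x)
    (hE : ∀ f ∈ E, f ≠ 0 → ∃ n, HasLeadingTerm K v x n f) (hz : z ^ 4 + z = x ^ 5) :
    (z ^ 2 + z ∉ E ∧ ∃ ϖ, 1 < v ϖ ∧
      ∀ f ∈ E ⊔ K⟮z ^ 2 + z⟯, f ≠ 0 → ∃ n, HasLeadingTerm K v ϖ n f) ∧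
    z ∉ E ⊔ K⟮z ^ 2 + z⟯ ∧ 1 < v (z / x) ∧
      ∀ f ∈ E ⊔ K⟮z⟯, f ≠ 0 → ∃ n, HasLeadingTerm K v (z / x) n f := by
  have h2 : (2 : Ω) = 0 := CharTwo.two_eq_zero
  obtain ⟨T, hT⟩ : ∃ T, T = z ^ 2 + z := ⟨_, rfl⟩
  have hT2 : T ^ 2 + T = x ^ 5 := by rw [hT]; linear_combination hz + (z ^ 3 + z ^ 2) * h2
  have hTv : 1 < v T := one_lt_map_of_one_lt_map_sq_add_self (by
    rw [hT2, map_pow]; exact one_lt_pow₀ hx (by norm_num))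
  have hzv : 1 < v z := one_lt_map_of_one_lt_map_sq_add_self (hT ▸ hTv)
  have hne {a : Ω} (ha : 1 < v a) : a ≠ 0 := v.ne_zero_iff.1 (zero_lt_one.trans ha).ne'
  have hunit {a : Ω} (ha : 1 < v a) : IsPrincipalUnit v (1 + a⁻¹) :=
    .one_add (by rw [map_inv₀]; exact inv_lt_one_of_one_lt₀ ha)
  have hx0 := hne hx
  have hT0 := hne hTv
  have hz0 := hne hzv
  -- `T / x ^ 2` and `z / x` have simple poles over `E(T)` and `E(z)` respectively
  have hπ : x = (T / x ^ 2) ^ 2 * (1 + T⁻¹) := by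
    field_simp
    linear_combination -hT2
  have hT5 : T = (T / x ^ 2) ^ (5 : ℤ) * (1 + T⁻¹) ^ 2 := by
    calc T = (T / x ^ 2) * x ^ 2 := by field_simp
      _ = (T / x ^ 2) * ((T / x ^ 2) ^ 2 * (1 + T⁻¹)) ^ 2 := by rw [← hπ]
      _ = (T / x ^ 2) ^ (5 : ℕ) * (1 + T⁻¹) ^ 2 := by ring
      _ = _ := by norm_cast
  have hϖ := one_lt_map_of_eq_sq_mul hx (hunit hTv) hπ
  have hπ' : T / x ^ 2 = (z / x) ^ 2 * (1 + z⁻¹) := by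
    field_simp
    linear_combination hT
  have hz5 : z = (z / x) ^ (5 : ℤ) * ((1 + z⁻¹) ^ 2 * (1 + T⁻¹)) := by
    calc z = (z / x) * x := by field_simp
      _ = (z / x) * ((T / x ^ 2) ^ 2 * (1 + T⁻¹)) := by rw [← hπ]
      _ = (z / x) * (((z / x) ^ 2 * (1 + z⁻¹)) ^ 2 * (1 + T⁻¹)) := by rw [hπ']
      _ = (z / x) ^ (5 : ℕ) * ((1 + z⁻¹) ^ 2 * (1 + T⁻¹)) := by ring
      _ = _ := by norm_cast
  have hϖ' := one_lt_map_of_eq_sq_mul hϖ (hunit hzv) hπ'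
  have h5 : Odd (5 : ℤ) := by decide
  have hTE : T ^ 2 + T ∈ E := hT2 ▸ pow_mem hxE 5
  have hE' (f : Ω) (hf : f ∈ E ⊔ K⟮T⟯) (hf0 : f ≠ 0) :=
    exists_hasLeadingTerm_sup_adjoin_simple hv hE hϖ (hunit hTv) hπ h5 ((hunit hTv).pow 2) hT5
      hTE hf hf0
  have hzE : z ^ 2 + z ∈ E ⊔ K⟮T⟯ :=
    hT ▸ (le_sup_right : _ ≤ E ⊔ K⟮T⟯) (mem_adjoin_simple_self K T)
  have hEz : E ⊔ K⟮z⟯ = E ⊔ K⟮T⟯ ⊔ K⟮z⟯ := by rw [hT, sup_adjoin_simple_sq_add_self]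
  rw [hEz, ← hT]
  exact ⟨⟨notMem_of_odd_pole hv hE hϖ (hunit hTv) hπ h5 ((hunit hTv).pow 2) hT5, _, hϖ, hE'⟩,
    notMem_of_odd_pole hv hE' hϖ' (hunit hzv) hπ' h5 (((hunit hzv).pow 2).mul (hunit hTv)) hz5,
    hϖ', fun f hf hf0 ↦ exists_hasLeadingTerm_sup_adjoin_simple hv hE' hϖ' (hunit hzv) hπ' h5
      (((hunit hzv).pow 2).mul (hunit hTv)) hz5 hzE hf hf0⟩

end TowerStep

/-! ### Function fields -/

section FunctionField

variable {K Ω Γ₀ : Type*} [Field K] [Field Ω] [Algebra K Ω] [LinearOrderedCommGroupWithZero Γ₀]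
  {v : Valuation Ω Γ₀}

/-- A finitely generated field, algebraic over `K(x)`, is a function field; leading terms at a pole
show that its constant field is `K`. -/
theorem isFunctionField_of_hasLeadingTerm (hv : ∀ c : K, c ≠ 0 → v (algebraMap K Ω c) = 1)
    {E : IntermediateField K Ω} {x ϖ : Ω} (hx : Transcendental K x) (hxE : x ∈ E) (hfg : E.FG)
    (halg : ∀ f ∈ E, IsAlgebraic K⟮x⟯ f) (hϖ : 1 < v ϖ)
    (hE : ∀ f ∈ E, f ≠ 0 → ∃ n, HasLeadingTerm K v ϖ n f) : IsFunctionField K E := by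
  refine ⟨⟨⟨x, hxE⟩, ?_, ?_⟩, ?_⟩
  · rwa [← transcendental_algebraMap_iff (algebraMap E Ω).injective]
  · let y : E := ⟨x, hxE⟩
    have : Algebra.EssFiniteType K E := essFiniteType_iff.2 hfg
    have : Algebra.EssFiniteType K⟮y⟯ E := .of_comp K K⟮y⟯ E
    have : Algebra.IsAlgebraic K⟮y⟯ E := ⟨fun f ↦ by
      have hf := halg f f.2
      rw [show x = (y : Ω) from rfl, ← lift_adjoin_simple] at hf
      exact (isAlgebraic_ringHom_iff_of_comp_eq (liftAlgEquiv K⟮y⟯) (algebraMap E Ω)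
        (algebraMap E Ω).injective rfl).1 hf⟩
    exact Algebra.finite_of_essFiniteType_of_isAlgebraic
  · refine le_bot_iff.1 fun f hf ↦ ?_
    rcases eq_or_ne f 0 with rfl | hf0
    · exact zero_mem _
    obtain ⟨n, hn⟩ := hE f f.2 (by simpa using hf0)
    have hf' : IsAlgebraic K (f : Ω) := (mem_algebraicClosure_iff.1 hf).algebraMap
    obtain ⟨c, hc⟩ := hn.mem_range_of_isAlgebraic hv hϖ hf'
    exact mem_bot.2 ⟨c, Subtype.ext hc⟩

end FunctionField

/-! ### Generators and change of the constant field -/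

section Generators

variable {Ω : Type*}

/-- Generators of `densifiedStep K x z t k s` over `K`, for `1 ≤ k`; they do not depend on `K`. -/
def densifiedGenerators (x z t : ℕ → Ω) (k : ℕ) (s : Fin 2) : Set Ω :=
  {x 1} ∪ z '' Set.Icc 2 k ∪ if s = 0 then ∅ else {t (k + 1)}

theorem finite_densifiedGenerators (x z t : ℕ → Ω) (k : ℕ) (s : Fin 2) :
    (densifiedGenerators x z t k s).Finite := by
  refine ((Set.finite_singleton _).union ((Set.finite_Icc _ _).image _)).union ?_
  split_ifs
  exacts [Set.finite_empty, Set.finite_singleton _]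

variable [Field Ω] (K : Type*) [Field K] [Algebra K Ω]

theorem gsStep_succ (x z : ℕ → Ω) {k : ℕ} (hk : 1 ≤ k) :
    gsStep K x z (k + 1) = gsStep K x z k ⊔ K⟮z (k + 1)⟯ := by
  obtain ⟨k, rfl⟩ := Nat.exists_eq_add_of_le' hk
  rfl

theorem gsStep_eq_adjoin (x z : ℕ → Ω) {k : ℕ} (hk : 1 ≤ k) :
    gsStep K x z k = adjoin K ({x 1} ∪ z '' Set.Icc 2 k) := by
  induction k, hk using Nat.le_induction with
  | base => simp [gsStep]
  | succ k hk ih =>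
    have hIcc : Set.Icc 2 (k + 1) = insert (k + 1) (Set.Icc 2 k) := by
      ext j
      simp only [Set.mem_Icc, Set.mem_insert_iff]
      lia
    rw [gsStep_succ K x z hk, ih, ← adjoin_union, Set.union_assoc, hIcc, Set.image_insert_eq,
      Set.union_singleton]

theorem densifiedStep_eq_adjoin (x z t : ℕ → Ω) {k : ℕ} (hk : 1 ≤ k) (s : Fin 2) :
    densifiedStep K x z t k s = adjoin K (densifiedGenerators x z t k s) := by
  rw [densifiedStep, densifiedGenerators, gsStep_eq_adjoin K x z hk]
  split_ifs
  · rw [Set.union_empty]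
  · rw [← adjoin_union]

variable {K}

theorem adjoin_adjoin_of_fieldRange_le {K' : Type*} [Field K'] [Algebra K' Ω]
    (h : (algebraMap K Ω).fieldRange ≤ (algebraMap K' Ω).fieldRange) (S : Set Ω) :
    adjoin K' (adjoin K S : Set Ω) = adjoin K' S := by
  refine le_antisymm (adjoin_le_iff.2 fun a ha ↦ ?_) (adjoin.mono _ _ _ (subset_adjoin K S))
  induction ha using adjoin_induction with
  | mem a ha => exact subset_adjoin K' S ha
  | algebraMap c =>
    obtain ⟨c', hc'⟩ := h ⟨c, rfl⟩
    exact hc' ▸ IntermediateField.algebraMap_mem _ c'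
  | add a b _ _ ha hb => exact add_mem ha hb
  | inv a _ ha => exact inv_mem ha
  | mul a b _ _ ha hb => exact mul_mem ha hb

end Generators

section FiniteFields

open Polynomial

variable {K Ω : Type*} [Field K] [Finite K] [Field Ω] [Algebra K Ω]

theorem mem_fieldRange_of_pow_natCard_eq {a : Ω} (ha : a ^ Nat.card K = a) :
    a ∈ (algebraMap K Ω).fieldRange := by
  have := Fintype.ofFinite K
  rw [Nat.card_eq_fintype_card] at ha
  have hs : (X ^ Fintype.card K - X : K[X]).Splits := by
    simpa using (FiniteField.isSplittingField_sub K K).splits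
  refine hs.mem_range_of_isRoot (FiniteField.X_pow_card_sub_X_ne_zero K Fintype.one_lt_card) ?_
  simp [ha]

theorem pow_natCard_algebraMap (c : K) : algebraMap K Ω c ^ Nat.card K = algebraMap K Ω c := by
  have := Fintype.ofFinite K
  rw [Nat.card_eq_fintype_card, ← map_pow, FiniteField.pow_card]

theorem fieldRange_le_of_natCard_eq_pow {K' : Type*} [Field K'] [Finite K'] [Algebra K' Ω] {n : ℕ}
    (h : Nat.card K' = Nat.card K ^ n) :
    (algebraMap K Ω).fieldRange ≤ (algebraMap K' Ω).fieldRange := by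
  rintro _ ⟨c, rfl⟩
  apply mem_fieldRange_of_pow_natCard_eq
  rw [h]
  clear h
  induction n with
  | zero => simp
  | succ n ih => rw [pow_succ, pow_mul, ih, pow_natCard_algebraMap]

theorem isAlgebraic_algebraMap_of_finite (F : Type*) [Field F] [Algebra F Ω] (c : K) :
    IsAlgebraic F (algebraMap K Ω c) := by
  refine ⟨X ^ Nat.card K - X, ?_, by simp [pow_natCard_algebraMap]⟩
  exact FiniteField.X_pow_card_sub_X_ne_zero F Finite.one_lt_card

end FiniteFields

/-! ### The tower over an arbitrary constant field of characteristic two -/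

section Tower

variable {K Ω : Type*} [Field K] [Field Ω] [Algebra K Ω] {x z t : ℕ → Ω}

/-- The place at infinity persists: wherever `x 1` has a pole, `x k` has a pole too, and every
nonzero element of the `k`-th field has a leading term that is a monomial in `x k`. -/
theorem hasLeadingTerm_gsStep {Γ₀ : Type*} [LinearOrderedCommGroupWithZero Γ₀]
    {v : Valuation Ω Γ₀} [CharP Ω 2]
    (hv : ∀ c : K, c ≠ 0 → v (algebraMap K Ω c) = 1) (hx : 1 < v (x 1))
    (hgs : IsGarciaStichtenothSequence 4 x z) {k : ℕ} (hk : 1 ≤ k) :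
    x k ∈ gsStep K x z k ∧ 1 < v (x k) ∧
      ∀ f ∈ gsStep K x z k, f ≠ 0 → ∃ n, HasLeadingTerm K v (x k) n f := by
  induction k, hk using Nat.le_induction with
  | base =>
    exact ⟨mem_adjoin_simple_self K _, hx, fun f hf hf0 ↦ hasLeadingTerm_adjoin_simple hv hx hf hf0⟩
  | succ k hk ih =>
    obtain ⟨hxE, hxk, hE⟩ := ih
    obtain ⟨-, -, h1, h2⟩ := ramified_tower_step hv hxE hxk hE (hgs.eqn k hk)
    rw [gsStep_succ K x z hk, hgs.quot k hk]
    refine ⟨div_mem ?_ ?_, h1, h2⟩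
    · exact (le_sup_right : _ ≤ gsStep K x z k ⊔ _) (mem_adjoin_simple_self K _)
    · exact (le_sup_left : gsStep K x z k ≤ _) hxE

open Polynomial in
theorem mem_of_pow_add_self_mem {F : Type*} [Field F] [Algebra F Ω] {n : ℕ} (hn : 1 < n) {a : Ω}
    (ha : a ^ n + a ∈ algebraicClosure F Ω) : a ∈ algebraicClosure F Ω := by
  have hp : (X ^ n + (X - C (⟨_, ha⟩ : algebraicClosure F Ω))).Monic :=
    monic_X_pow_add (by rw [degree_X_sub_C]; exact_mod_cast hn)
  have halg : IsAlgebraic (algebraicClosure F Ω) a :=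
    ⟨_, hp.ne_zero, by simp [IntermediateField.algebraMap_apply]⟩
  exact mem_algebraicClosure_iff.2 (halg.restrictScalars F)

theorem isAlgebraic_of_mem_densifiedStep (hgs : IsGarciaStichtenothSequence 4 x z)
    (ht : ∀ k, 1 ≤ k → t (k + 1) ^ 2 + t (k + 1) = x k ^ 5) {k : ℕ} (hk : 1 ≤ k) (s : Fin 2) {f : Ω}
    (hf : f ∈ densifiedStep K x z t k s) : IsAlgebraic K⟮x 1⟯ f := by
  let C := algebraicClosure K⟮x 1⟯ Ω
  have hx (k) (hk : 1 ≤ k) : x k ∈ C ∧ (2 ≤ k → z k ∈ C) := by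
    induction k, hk using Nat.le_induction with
    | base => exact ⟨C.algebraMap_mem (AdjoinSimple.gen K (x 1)), by lia⟩
    | succ k hk ih =>
      have hz : z (k + 1) ∈ C :=
        mem_of_pow_add_self_mem (n := 4) (by lia) (hgs.eqn k hk ▸ pow_mem ih.1 5)
      exact ⟨hgs.quot k hk ▸ div_mem hz ih.1, fun _ ↦ hz⟩
  have hle : densifiedStep K x z t k s ≤ C.restrictScalars K := by
    rw [densifiedStep_eq_adjoin K x z t hk, adjoin_le_iff, densifiedGenerators]
    refine Set.union_subset (Set.union_subset ?_ ?_) ?_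
    · exact Set.singleton_subset_iff.2 (hx 1 le_rfl).1
    · rintro _ ⟨j, hj, rfl⟩
      exact (hx j (by have := hj.1; lia)).2 hj.1
    · split_ifs
      · exact Set.empty_subset _
      · exact Set.singleton_subset_iff.2
          (mem_of_pow_add_self_mem (n := 2) (by lia) (ht k hk ▸ pow_mem (hx k hk).1 5))
  exact mem_algebraicClosure_iff.1 (hle hf)

theorem isQuadraticTower_densifiedStep [CharP Ω 2] (hx : Transcendental K (x 1))
    (hgs : IsGarciaStichtenothSequence 4 x z)
    (ht : ∀ k, 1 ≤ k → t (k + 1) ^ 2 + t (k + 1) = x k ^ 5) :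
    IsQuadraticTower (densifiedStep K x z t) := by
  obtain ⟨V, hV, hxV⟩ := exists_valuationSubring_of_transcendental hx
  have hv (c : K) (hc : c ≠ 0) : V.valuation (algebraMap K Ω c) = 1 := by
    refine le_antisymm ((V.valuation_le_one_iff _).2 (hV c)) ?_
    have := (V.valuation_le_one_iff _).2 (hV c⁻¹)
    rwa [map_inv₀, map_inv₀, inv_le_one₀ (zero_lt_iff.2 (by simpa using hc))] at this
  have hxv : 1 < V.valuation (x 1) := by
    rwa [← not_le, V.valuation_le_one_iff]
  have key (k : ℕ) (hk : 1 ≤ k) := hasLeadingTerm_gsStep hv hxv hgs hk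
  have h0 (k) : densifiedStep K x z t k 0 = gsStep K x z k := rfl
  have h2 : (2 : Ω) = 0 := CharTwo.two_eq_zero
  have hts (k) (hk : 1 ≤ k) : K⟮t (k + 1)⟯ = K⟮z (k + 1) ^ 2 + z (k + 1)⟯ := by
    refine adjoin_simple_eq_of_sq_add_self_eq ?_
    rw [ht k hk]
    linear_combination -hgs.eqn k hk - (z (k + 1) ^ 3 + z (k + 1) ^ 2) * h2
  have h1 (k) (hk : 1 ≤ k) : densifiedStep K x z t k 1 =
      gsStep K x z k ⊔ K⟮z (k + 1) ^ 2 + z (k + 1)⟯ := by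
    rw [← hts k hk]
    rfl
  refine ⟨fun k hk s ↦ ?_, fun k hk ↦ ?_, fun k hk ↦ ?_⟩
  · obtain ⟨ϖ, hϖ, hE⟩ : ∃ ϖ, 1 < V.valuation ϖ ∧ ∀ f ∈ densifiedStep K x z t k s, f ≠ 0 →
        ∃ n, HasLeadingTerm K V.valuation ϖ n f := by
      obtain ⟨hxE, hxk, hE⟩ := key k hk
      obtain rfl | rfl : s = 0 ∨ s = 1 := by fin_cases s <;> simp
      · exact ⟨_, hxk, hE⟩
      · rw [h1 k hk]
        exact (ramified_tower_step hv hxE hxk hE (hgs.eqn k hk)).1.2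
    refine isFunctionField_of_hasLeadingTerm hv hx ?_ ?_
      (fun f hf ↦ isAlgebraic_of_mem_densifiedStep hgs ht hk s hf) hϖ hE
    · rw [densifiedStep_eq_adjoin K x z t hk]
      exact subset_adjoin _ _ (.inl (.inl rfl))
    · rw [densifiedStep_eq_adjoin K x z t hk]
      exact fg_adjoin_of_finite (finite_densifiedGenerators x z t k s)
  · obtain ⟨hxE, hxk, hE⟩ := key k hk
    rw [h0, h1 k hk]
    refine isQuadraticGalois_sup_adjoin_simple ?_
      (ramified_tower_step hv hxE hxk hE (hgs.eqn k hk)).1.1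
    convert pow_mem hxE 5 using 1
    linear_combination hgs.eqn k hk + (z (k + 1) ^ 3 + z (k + 1) ^ 2) * h2
  · obtain ⟨hxE, hxk, hE⟩ := key k hk
    rw [h0, h1 k hk, gsStep_succ K x z hk,
      ← sup_adjoin_simple_sq_add_self (gsStep K x z k) (z (k + 1))]
    exact isQuadraticGalois_sup_adjoin_simple
      ((le_sup_right : _ ≤ gsStep K x z k ⊔ _) (mem_adjoin_simple_self K _))
      (ramified_tower_step hv hxE hxk hE (hgs.eqn k hk)).2.1

theorem isConstantFieldExtension_densifiedStep {K' : Type*} [Field K'] [Finite K'] [Finite K]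
    [Algebra K' Ω] {n : ℕ} (hcard : Nat.card K' = Nat.card K ^ n)
    (h : IsQuadraticTower (densifiedStep K x z t)) (h' : IsQuadraticTower (densifiedStep K' x z t))
    {k : ℕ} (hk : 1 ≤ k) (s : Fin 2) :
    IsConstantFieldExtension (densifiedStep K x z t k s) (densifiedStep K' x z t k s) where
  base := h.functionField k hk s
  top := h'.functionField k hk s
  constants_le := fieldRange_le_of_natCard_eq_pow hcard
  constants_algebraic := isAlgebraic_algebraMap_of_finite K
  compositum := by
    rw [densifiedStep_eq_adjoin K x z t hk, densifiedStep_eq_adjoin K' x z t hk,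
      adjoin_adjoin_of_fieldRange_le (fieldRange_le_of_natCard_eq_pow hcard)]

end Tower

/-! ### Existence of generators and the finite constant fields -/

section Existence

variable {Ω : Type*} [Field Ω] [IsAlgClosed Ω]

open Polynomial in
theorem exists_pow_add_self_eq {n : ℕ} (hn : 1 < n) (a : Ω) : ∃ b : Ω, b ^ n + b = a := by
  have hd : (X ^ n + (X - C a)).degree = (n : WithBot ℕ) := by
    rw [degree_add_eq_left_of_degree_lt, degree_X_pow]
    rw [degree_X_pow, degree_X_sub_C]
    exact_mod_cast hn
  obtain ⟨b, hb⟩ := IsAlgClosed.exists_root (X ^ n + (X - C a)) (by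
    rw [hd]; exact_mod_cast (by lia : n ≠ 0))
  exact ⟨b, by simpa [IsRoot, ← add_sub_assoc, sub_eq_zero] using hb⟩

theorem exists_isGarciaStichtenothSequence {q : ℕ} (hq : 1 < q) (x₁ : Ω) :
    ∃ x z : ℕ → Ω, x 1 = x₁ ∧ IsGarciaStichtenothSequence q x z := by
  choose r hr using fun a : Ω ↦ exists_pow_add_self_eq hq a
  -- the sequence `x 1, x 2, …`, indexed from `0`
  let y : ℕ → Ω := fun k ↦ Nat.rec x₁ (fun _ a ↦ r (a ^ (q + 1)) / a) k
  refine ⟨fun k ↦ y (k - 1), fun k ↦ r (y (k - 2) ^ (q + 1)), rfl, fun k hk ↦ ?_, fun k hk ↦ ?_⟩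
  · obtain ⟨k, rfl⟩ := Nat.exists_eq_add_of_le' hk
    exact hr _
  · obtain ⟨k, rfl⟩ := Nat.exists_eq_add_of_le' hk
    rfl

end Existence

theorem proposition5 {Ω : Type*} [Field Ω] [Algebra (ZMod 2) Ω]
    [Algebra (GaloisField 2 2) Ω] [Algebra (GaloisField 2 4) Ω] :
    -- generators exist over every transcendental `x₁`, in an algebraically closed `Ω`
    (IsAlgClosed Ω → ∀ x₁ : Ω, Transcendental (ZMod 2) x₁ →
      ∃ x z t : ℕ → Ω, x 1 = x₁ ∧ IsDensifiedSequence x z t) ∧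
    -- and for every choice of generators in any `Ω`:
    (∀ x z t : ℕ → Ω, IsDensifiedSequence x z t →
      -- `T₁`, `T₂`, `T₃` are towers over `𝔽₁₆`, `𝔽₄`, `𝔽₂`
      IsQuadraticTower (densifiedStep (GaloisField 2 4) x z t) ∧
      IsQuadraticTower (densifiedStep (GaloisField 2 2) x z t) ∧
      IsQuadraticTower (densifiedStep (ZMod 2) x z t) ∧
      -- and `F = 𝔽₁₆ H`, `G = 𝔽₄ H`, `F = 𝔽₁₆ G` are constant field extensions
      ∀ k, 1 ≤ k → ∀ s : Fin 2,
        IsConstantFieldExtension (densifiedStep (ZMod 2) x z t k s)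
          (densifiedStep (GaloisField 2 4) x z t k s) ∧
        IsConstantFieldExtension (densifiedStep (ZMod 2) x z t k s)
          (densifiedStep (GaloisField 2 2) x z t k s) ∧
        IsConstantFieldExtension (densifiedStep (GaloisField 2 2) x z t k s)
          (densifiedStep (GaloisField 2 4) x z t k s)) := by
  have : CharP Ω 2 := charP_of_injective_algebraMap (algebraMap (ZMod 2) Ω).injective 2
  refine ⟨fun _ x₁ hx₁ ↦ ?_, fun x z t h ↦ ?_⟩
  · obtain ⟨x, z, rfl, hgs⟩ := exists_isGarciaStichtenothSequence (q := 4) (by norm_num) x₁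
    choose r hr using fun a : Ω ↦ exists_pow_add_self_eq (n := 2) (by norm_num) a
    exact ⟨x, z, fun k ↦ r (x (k - 1) ^ 5), rfl, hx₁, hgs, fun k _ ↦ hr _⟩
  · have htr {K : Type} [Field K] [Algebra K Ω] [Algebra (ZMod 2) K] [Finite K] :
        Transcendental K (x 1) := fun hx ↦
      have : IsScalarTower (ZMod 2) K Ω := .of_algebraMap_eq' (Subsingleton.elim _ _)
      have : Algebra.IsAlgebraic (ZMod 2) K := Algebra.IsAlgebraic.of_finite _ _
      h.transcendental (hx.restrictScalars (ZMod 2))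
    have h16 := isQuadraticTower_densifiedStep (K := GaloisField 2 4) htr h.gs h.eqn_t
    have h4 := isQuadraticTower_densifiedStep (K := GaloisField 2 2) htr h.gs h.eqn_t
    have h2 := isQuadraticTower_densifiedStep h.transcendental h.gs h.eqn_t
    have c16 : Nat.card (GaloisField 2 4) = 16 := GaloisField.card 2 4 (by norm_num)
    have c4 : Nat.card (GaloisField 2 2) = 4 := GaloisField.card 2 2 (by norm_num)
    have c2 : Nat.card (ZMod 2) = 2 := Nat.card_zmod 2
    refine ⟨h16, h4, h2, fun k hk s ↦ ⟨?_, ?_, ?_⟩⟩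
    · exact isConstantFieldExtension_densifiedStep (n := 4) (by rw [c16, c2]; rfl) h2 h16 hk s
    · exact isConstantFieldExtension_densifiedStep (n := 2) (by rw [c4, c2]; rfl) h2 h4 hk s
    · exact isConstantFieldExtension_densifiedStep (n := 2) (by rw [c16, c4]; rfl) h4 h16 hk s
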